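/- **Proposition (three-term relation for $S_{4,2}$).** For integers $n,p\ge 1$ and $z\in\mathbb{C}\setminus[1,\infty)$ let $$S_{n,p}(z)=\frac{(-1)^{n+p-1}}{(n-1)!\,p!}\int_0^1\log^{n-1}(t)\,\log^p(1-zt)\,\frac{dt}{t}$$ be the Nielsen polylogarithm, and let $\mathrm{Li}_1(z)=-\log(1-z)$, $\mathrm{Li}_m(z)=\int_0^z\mathrm{Li}_{m-1}(s)\,\frac{ds}{s}$ ($m\ge2$, integration along the straight segment from $0$ to $z$) be the classical polylogarithms on $\mathbb{C}\setminus[1,\infty)$; $\log$ is the principal branch and $\zeta$ is the Riemann zeta function. Then for all $z\in\mathbb{C}\setminus\big((-\infty,0]\cup[1,\infty)\big)$, $$\begin{aligned} &S_{4,2}(1-z)+S_{4,2}(z)+S_{4,2}\Big(\frac{z}{z-1}\Big)\\ &=2\,\mathrm{Li}_6(1-z)+2\,\mathrm{Li}_6(z)+2\,\mathrm{Li}_6\Big(\frac{z}{z-1}\Big)-\Big(\mathrm{Li}_5(z)-\mathrm{Li}_5\Big(\frac{z}{z-1}\Big)\Big)\log(1-z)-\mathrm{Li}_5(1-z)\log(z)\\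 &\quad-\frac{3}{6!}\log^6(1-z)+\frac{2}{5!}\log(z)\log^5(1-z)-\frac{1}{2!\,4!}\log^2(z)\log^4(1-z)-\frac{2}{4!}\zeta(2)\log^4(1-z)\\ &\quad+\frac{1}{3!}\zeta(2)\log(z)\log^3(1-z)-\frac{1}{3!}\zeta(3)\log^3(1-z)+\frac{1}{2!}\zeta(3)\log(z)\log^2(1-z)-\frac{7}{4\cdot2!}\zeta(4)\log^2(1-z)\\ &\quad+\zeta(4)\log(z)\log(1-z)+\zeta(5)\log(z)-\zeta(2)\zeta(3)\log(1-z)-\Big(\frac12\zeta(3)^2+\frac54\zeta(6)\Big). \end{aligned}$$ -/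

import Mathlib

/-- The principal branch of the classical polylogarithm `Li_m` on the plane cut along `[1, ∞)`:
`Li_1(z) = -log(1 - z)` and `Li_m(z) = ∫_0^z Li_{m-1}(s) ds/s` for `m ≥ 2`, where the path is
the straight segment `s = t z`, `0 ≤ t ≤ 1`, so that `ds/s = dt/t`.
The case `m = 0` is the usual `Li_0(z) = z/(1 - z)`. -/
noncomputable def classicalPolylog : ℕ → ℂ → ℂ
  | 0, z => z / (1 - z)
  | 1, z => -Complex.log (1 - z)
  | m + 2, z => ∫ t in (0 : ℝ)..1, classicalPolylog (m + 1) ((t : ℂ) * z) / (t : ℂ)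

/-- Nielsen's generalised polylogarithm, for `n, p ≥ 1`, on the plane cut along `[1, ∞)`:
`S_{n,p}(z) = (-1)^(n+p-1) / ((n-1)! p!) * ∫_0^1 log^(n-1)(t) log^p(1 - z t) dt/t`. -/
noncomputable def nielsenPolylog (n p : ℕ) (z : ℂ) : ℂ :=
  (-1 : ℂ) ^ (n + p - 1) / (((n - 1).factorial : ℂ) * (p.factorial : ℂ)) *
    ∫ t in (0 : ℝ)..1,
      (Real.log t : ℂ) ^ (n - 1) * Complex.log (1 - z * (t : ℂ)) ^ p / (t : ℂ)

/-! Iterating `g ↦ ∫ g(s) ds/s` from 0, starting with `S_{0,p} = (-log(1-z))^p/p!`, gives functions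
with `S_{n+1,p}' = S_{n,p}/z`. Integration by parts identifies them with Nielsen's integrals
(`nielsenPolylog_eq_nielsenIter`), and `Li_{m+1} = S_{m,1}`.

Two functional equations carry the proof: `sum_nielsenIter_div_sub_one` for `z/(z-1)` and
`sum_nielsenIter_one_sub` for `1-z`. In each, a truncated exponential in `log(1-z)` multiplies the
transformed functions so that the unwanted part of the derivative telescopes. Both sides then have
the same derivative on a connected domain and the same limit as `z → 0+`.

Multiplying by the inverse exponential isolates `S_{4,2}` and `S_{5,1} = Li_6` at `1-z` and
`z/(z-1)` in terms of functions of `z`. Modulo products, `S_{4,2}(z/(z-1)) - 2 Li_6(z/(z-1))` is `2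
S_{5,1} - S_{4,2} + S_{2,4} - 2 S_{1,5}` at `z`. The term `-S_{4,2}` cancels `S_{4,2}(z)`, the last
two cancel against the `1-z` equations, and `2 Li_6(z)` remains.

The constants are `S_{n,1}(1) = ζ(n+1)` and `S_{n,2}(1) = ζ(n+1,1)`; Euler's sum formula and the
stuffle product reduce the latter to ordinary zeta values. -/

open Complex Set Filter Topology MeasureTheory intervalIntegral

/-! ### The two cut planes -/

/-- The plane cut along `[1, ∞)`. -/
def cutPlane : Set ℂ := {z | 1 - z ∈ slitPlane}

/-- The plane cut along `(-∞, 0]` and `[1, ∞)`. -/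
def doublyCutPlane : Set ℂ := {z | z ∈ slitPlane ∧ 1 - z ∈ slitPlane}

theorem isOpen_cutPlane : IsOpen cutPlane :=
  isOpen_slitPlane.preimage (by fun_prop : Continuous fun z : ℂ => 1 - z)

theorem isOpen_doublyCutPlane : IsOpen doublyCutPlane :=
  isOpen_slitPlane.inter isOpen_cutPlane

theorem zero_mem_cutPlane : (0 : ℂ) ∈ cutPlane := by
  simp [cutPlane]

theorem cutPlane_mem_nhds {z : ℂ} (hz : z ∈ cutPlane) : cutPlane ∈ 𝓝 z :=
  isOpen_cutPlane.mem_nhds hz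

theorem ofReal_mul_mem_cutPlane {z : ℂ} (hz : z ∈ cutPlane) {t : ℝ} (h0 : 0 ≤ t) (h1 : t ≤ 1) :
    (t : ℂ) * z ∈ cutPlane := by
  have h := starConvex_one_slitPlane hz (sub_nonneg.2 h1) h0 (by ring)
  have e : 1 - (t : ℂ) * z = (1 - t : ℝ) • (1 : ℂ) + t • (1 - z) := by
    simp only [real_smul]; push_cast; ring
  simpa [cutPlane, e] using h

theorem doublyCutPlane_isPreconnected : IsPreconnected doublyCutPlane := by
  -- The slit plane is star-shaped about every positive real; 1/2 is the centre fixed by `z ↦ 1 -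
  -- z`, so it serves both conditions.
  have h : StarConvex ℝ ((1 / 2 : ℝ) : ℂ) doublyCutPlane := by
    intro z hz s t hs ht hst
    refine ⟨starConvex_ofReal_slitPlane (by norm_num) hz.1 hs ht hst, ?_⟩
    have := starConvex_ofReal_slitPlane (x := 1 / 2) (by norm_num) hz.2 hs ht hst
    convert this using 1
    have : (s : ℂ) + t = 1 := by exact_mod_cast hst
    simp only [real_smul]
    push_cast
    linear_combination -this
  refine (h.isPathConnected ⟨Or.inl ?_, Or.inl ?_⟩).isConnected.isPreconnected
  · rw [ofReal_re]; norm_num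
  · rw [sub_re, one_re, ofReal_re]; norm_num

/-! ### Radial primitives for `ds/s` -/

/-- The integral of `g(s) ds / s` along the segment from `0` to `z`. -/
noncomputable def radialIntegral (g : ℂ → ℂ) (z : ℂ) : ℂ :=
  ∫ t in (0 : ℝ)..1, g ((t : ℂ) * z) / (t : ℂ)

theorem radialIntegral_zero {g : ℂ → ℂ} (h0 : g 0 = 0) : radialIntegral g 0 = 0 := by
  simp [radialIntegral, h0]

theorem apply_ofReal_mul_div {g : ℂ → ℂ} (h0 : g 0 = 0) (z : ℂ) {t : ℝ} (ht : t ≠ 0) :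
    g ((t : ℂ) * z) / (t : ℂ) = z * dslope g 0 (t * z) := by
  have h := sub_smul_dslope g 0 ((t : ℂ) * z)
  simp only [sub_zero, smul_eq_mul, h0] at h
  have : (t : ℂ) ≠ 0 := by exact_mod_cast ht
  rw [← h]
  field_simp

/-- Since `g` vanishes at 0, the singularity at `t = 0` is removable; `dslope` supplies an integrand
that is regular there. -/
theorem radialIntegral_eq_integral_dslope {g : ℂ → ℂ} (h0 : g 0 = 0) (z : ℂ) :
    radialIntegral g z = ∫ t in (0 : ℝ)..1, z * dslope g 0 (t * z) := by
  refine integral_congr_ae (ae_of_all _ fun t ht => ?_)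
  rw [uIoc_of_le zero_le_one] at ht
  exact apply_ofReal_mul_div h0 z ht.1.ne'

theorem differentiableOn_dslope_cutPlane {g : ℂ → ℂ} (hg : DifferentiableOn ℂ g cutPlane) :
    DifferentiableOn ℂ (dslope g 0) cutPlane :=
  (Complex.differentiableOn_dslope (cutPlane_mem_nhds zero_mem_cutPlane)).2 hg

theorem continuousOn_comp_ofReal_mul {h : ℂ → ℂ} (hh : ContinuousOn h cutPlane) {z : ℂ}
    (hz : z ∈ cutPlane) : ContinuousOn (fun t : ℝ => h (t * z)) (Icc 0 1) :=
  hh.comp (by fun_prop) fun _ ht => ofReal_mul_mem_cutPlane hz ht.1 ht.2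

/-- With `h = dslope g 0`, differentiating `w * h(tw)` in `w` gives `h(tw) + tw h'(tw)`, which is
also the `t`-derivative of `t h(tw)`. Its integral over `[0,1]` is therefore `h(w)`. Compactness
supplies the bound for differentiating under the integral. -/
theorem hasDerivAt_radialIntegral_dslope {g : ℂ → ℂ} (hg : DifferentiableOn ℂ g cutPlane)
    (h0 : g 0 = 0) {z : ℂ} (hz : z ∈ cutPlane) :
    HasDerivAt (radialIntegral g) (dslope g 0 z) z := by
  set h := dslope g 0 with hdef
  have hh : DifferentiableOn ℂ h cutPlane := differentiableOn_dslope_cutPlane hg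
  have hh' : DifferentiableOn ℂ (deriv h) cutPlane := hh.deriv isOpen_cutPlane
  have hhd : ∀ w ∈ cutPlane, HasDerivAt h (deriv h w) w := fun w hw =>
    (hh.differentiableAt (cutPlane_mem_nhds hw)).hasDerivAt
  obtain ⟨ε, hε, hball⟩ := Metric.nhds_basis_closedBall.mem_iff.1 (cutPlane_mem_nhds hz)
  have hmaps : MapsTo (fun q : ℂ × ℝ => (q.2 : ℂ) * q.1)
      (Metric.closedBall z ε ×ˢ Icc (0 : ℝ) 1) cutPlane := fun q hq =>
    ofReal_mul_mem_cutPlane (hball hq.1) hq.2.1 hq.2.2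
  have hcont : ContinuousOn (fun q : ℂ × ℝ => h (q.2 * q.1) + q.1 * (deriv h (q.2 * q.1) * q.2))
      (Metric.closedBall z ε ×ˢ Icc (0 : ℝ) 1) := by
    have h1 := hh.continuousOn.comp (by fun_prop) hmaps
    have h2 := hh'.continuousOn.comp (by fun_prop) hmaps
    exact h1.add ((by fun_prop : Continuous fun q : ℂ × ℝ => q.1).continuousOn.mul
      (h2.mul (by fun_prop : Continuous fun q : ℂ × ℝ => (q.2 : ℂ)).continuousOn))
  obtain ⟨C, hC⟩ := ((isCompact_closedBall z ε).prod isCompact_Icc).exists_bound_of_continuousOn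
    hcont
  have hF : ∀ w ∈ cutPlane, IntervalIntegrable (fun t : ℝ => w * h (t * w)) volume 0 1 :=
    fun w hw => ContinuousOn.intervalIntegrable_of_Icc zero_le_one
      (continuousOn_const.mul (continuousOn_comp_ofReal_mul hh.continuousOn hw))
  have hF'cont : ContinuousOn (fun t : ℝ => h (t * z) + z * (deriv h (t * z) * t)) (Icc 0 1) :=
    (continuousOn_comp_ofReal_mul hh.continuousOn hz).add (continuousOn_const.mul
      ((continuousOn_comp_ofReal_mul hh'.continuousOn hz).mul (by fun_prop)))
  have hF' : IntervalIntegrable (fun t : ℝ => h (t * z) + z * (deriv h (t * z) * t)) volume 0 1 :=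
    hF'cont.intervalIntegrable_of_Icc zero_le_one
  have key := (hasDerivAt_integral_of_dominated_loc_of_deriv_le (μ := volume) (a := 0) (b := 1)
    (F := fun w t => w * h (t * w)) (F' := fun w t => h (t * w) + w * (deriv h (t * w) * t))
    (x₀ := z) (s := Metric.closedBall z ε) (bound := fun _ => C)
    (Metric.closedBall_mem_nhds z hε)
    (by
      filter_upwards [cutPlane_mem_nhds hz] with w hw
      exact (intervalIntegrable_iff.1 (hF w hw)).aestronglyMeasurable)
    (hF z hz) (intervalIntegrable_iff.1 hF').aestronglyMeasurable
    (ae_of_all _ fun t ht w hw => by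
      rw [uIoc_of_le zero_le_one] at ht
      exact hC (w, t) ⟨hw, ht.1.le, ht.2⟩)
    intervalIntegrable_const
    (ae_of_all _ fun t ht w hw => by
      rw [uIoc_of_le zero_le_one] at ht
      have h1 : HasDerivAt (fun w : ℂ => (t : ℂ) * w) t w := by
        simpa using (hasDerivAt_id w).const_mul (t : ℂ)
      have h2 := (hhd _ (ofReal_mul_mem_cutPlane (hball hw) ht.1.le ht.2)).comp w h1
      refine ((hasDerivAt_id w).mul h2).congr_deriv ?_
      simp only [Function.comp, id]
      ring)).2
  have hint : ∫ t in (0 : ℝ)..1, (h (t * z) + z * (deriv h (t * z) * t)) = h z := by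
    rw [integral_eq_sub_of_hasDerivAt (f := fun t : ℝ => (t : ℂ) * h (t * z))]
    · simp
    · intro t ht
      rw [uIcc_of_le zero_le_one] at ht
      have h1 : HasDerivAt (fun t : ℝ => (t : ℂ) * z) z t := by
        simpa using (hasDerivAt_id t).ofReal_comp.mul_const z
      have h2 := (hhd _ (ofReal_mul_mem_cutPlane hz ht.1 ht.2)).comp_of_eq t h1 rfl
      have h3 : HasDerivAt (fun t : ℝ => (t : ℂ)) 1 t := (hasDerivAt_id t).ofReal_comp
      refine (h3.mul h2).congr_deriv ?_
      simp only [Function.comp]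
      ring
    · exact hF'
  rw [hint] at key
  rwa [show radialIntegral g = fun w => ∫ t in (0 : ℝ)..1, w * h (t * w) from
    funext fun w => radialIntegral_eq_integral_dslope h0 w]

theorem hasDerivAt_radialIntegral {g : ℂ → ℂ} (hg : DifferentiableOn ℂ g cutPlane)
    (h0 : g 0 = 0) {z : ℂ} (hz : z ∈ cutPlane) (hz0 : z ≠ 0) :
    HasDerivAt (radialIntegral g) (g z / z) z := by
  convert hasDerivAt_radialIntegral_dslope hg h0 hz using 1
  simp [dslope_of_ne g hz0, slope_def_field, h0]

theorem differentiableOn_radialIntegral {g : ℂ → ℂ} (hg : DifferentiableOn ℂ g cutPlane)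
    (h0 : g 0 = 0) : DifferentiableOn ℂ (radialIntegral g) cutPlane := fun _ hz =>
  (hasDerivAt_radialIntegral_dslope hg h0 hz).differentiableAt.differentiableWithinAt

/-! ### Logarithmic weights and integration by parts -/

theorem intervalIntegrable_log_pow (k : ℕ) :
    IntervalIntegrable (fun t : ℝ => Real.log t ^ k) volume 0 1 := by
  rcases Nat.eq_zero_or_pos k with rfl | hk
  · simp
  have hk' : (0 : ℝ) < k := by exact_mod_cast hk
  -- The majorant is the `k`-th power of `|log t| ≤ 2k * t^(-1/(2k))`; the exponent is chosen to
  -- leave the integrable `t^(-1/2)`.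
  have hb : IntervalIntegrable (fun t : ℝ => (2 * k : ℝ) ^ k * t ^ (-(1 / 2) : ℝ)) volume 0 1 :=
    (intervalIntegrable_rpow' (by norm_num)).const_mul _
  refine hb.mono_fun (Real.measurable_log.pow_const k).aestronglyMeasurable ?_
  refine (ae_restrict_iff' measurableSet_uIoc).2 (ae_of_all _ fun t ht => ?_)
  rw [uIoc_of_le zero_le_one] at ht
  have h := (Real.abs_log_mul_self_rpow_lt t (1 / (2 * k)) ht.1 ht.2 (by positivity)).le
  have h2 := pow_le_pow_left₀ (abs_nonneg _) h k
  have e : (t ^ (1 / (2 * k) : ℝ)) ^ k = t ^ (1 / 2 : ℝ) := by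
    rw [← Real.rpow_natCast, ← Real.rpow_mul ht.1.le]
    congr 1
    field_simp
  have hp : 0 < t ^ (1 / 2 : ℝ) := Real.rpow_pos_of_pos ht.1 _
  rw [abs_mul, mul_pow, abs_of_pos (Real.rpow_pos_of_pos ht.1 _), e, one_div_one_div] at h2
  simp only
  rw [norm_pow, Real.norm_eq_abs, Real.norm_of_nonneg (by have := ht.1; positivity),
    Real.rpow_neg ht.1.le, ← div_eq_mul_inv, le_div_iff₀ hp]
  exact h2

theorem tendsto_pow_log_mul_self (k : ℕ) :
    Tendsto (fun t : ℝ => Real.log t ^ k * t) (𝓝[>] 0) (𝓝 0) := by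
  rcases Nat.eq_zero_or_pos k with rfl | hk
  · simpa [id_def] using!
      (continuous_id.tendsto (0 : ℝ)).mono_left (nhdsWithin_le_nhds (s := Ioi 0))
  have hk' : (0 : ℝ) < k := by exact_mod_cast hk
  have h := (tendsto_log_mul_rpow_nhdsGT_zero (r := 1 / k) (by positivity)).pow k
  rw [zero_pow hk.ne'] at h
  refine h.congr' ?_
  filter_upwards [self_mem_nhdsWithin] with t ht
  have ht : 0 < t := ht
  rw [mul_pow, ← Real.rpow_natCast (t ^ _), ← Real.rpow_mul ht.le, one_div_mul_cancel hk'.ne',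
    Real.rpow_one]

/-- Integration by parts, with `g(tz)/t` the `t`-derivative of the radial integral: one logarithm is
traded for one more iteration. The boundary term vanishes at 0 because the radial integral is
`O(t)`, and at 1 because `log 1 = 0`. -/
theorem integral_log_pow_succ_mul {g : ℂ → ℂ} (hg : DifferentiableOn ℂ g cutPlane)
    (h0 : g 0 = 0) {z : ℂ} (hz : z ∈ cutPlane) (k : ℕ) :
    ∫ t in (0 : ℝ)..1, (Real.log t : ℂ) ^ (k + 1) * g (t * z) / t =
      -(k + 1) * ∫ t in (0 : ℝ)..1, (Real.log t : ℂ) ^ k * radialIntegral g (t * z) / t := by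
  have hint : ∀ {f : ℂ → ℂ}, DifferentiableOn ℂ f cutPlane → f 0 = 0 → ∀ j : ℕ,
      IntervalIntegrable (fun t : ℝ => (Real.log t : ℂ) ^ j * f (t * z) / t) volume 0 1 := by
    intro f hf hf0 j
    have h1 : IntervalIntegrable (fun t : ℝ => (Real.log t : ℂ) ^ j) volume 0 1 := by
      have h := intervalIntegrable_log_pow j
      rw [intervalIntegrable_iff] at h ⊢
      simpa [IntegrableOn] using h.ofReal (𝕜 := ℂ)
    have h2 : ContinuousOn (fun t : ℝ => z * dslope f 0 (t * z)) (uIcc 0 1) := by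
      rw [uIcc_of_le zero_le_one]
      exact continuousOn_const.mul (continuousOn_comp_ofReal_mul
        (differentiableOn_dslope_cutPlane hf).continuousOn hz)
    refine (h1.mul_continuousOn h2).congr fun t ht => ?_
    rw [uIoc_of_le zero_le_one] at ht
    change _ * (z * _) = _
    rw [← apply_ofReal_mul_div hf0 z ht.1.ne', mul_div_assoc]
  have hG := differentiableOn_radialIntegral hg h0
  have hG0 := radialIntegral_zero h0
  have hGint := hint hG hG0 k
  have hgint := hint hg h0 (k + 1)
  have hfun : ∀ t : ℝ, 0 < t → t < 1 →
      (Real.log t : ℂ) ^ (k + 1) * radialIntegral g (t * z) =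
        ((Real.log t ^ (k + 1) * t : ℝ) : ℂ) * (z * dslope (radialIntegral g) 0 (t * z)) := by
    intro t ht _
    have : (t : ℂ) ≠ 0 := by exact_mod_cast ht.ne'
    rw [← apply_ofReal_mul_div hG0 z ht.ne']
    push_cast
    field_simp
  have hlim0 : Tendsto (fun t : ℝ => (Real.log t : ℂ) ^ (k + 1) * radialIntegral g (t * z))
      (𝓝[>] 0) (𝓝 0) := by
    have h1 : Tendsto (fun t : ℝ => ((Real.log t ^ (k + 1) * t : ℝ) : ℂ)) (𝓝[>] 0) (𝓝 0) := by
      have := (continuous_ofReal.tendsto 0).comp (tendsto_pow_log_mul_self (k + 1))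
      rwa [ofReal_zero] at this
    have h2 : ContinuousWithinAt (fun t : ℝ => z * dslope (radialIntegral g) 0 (t * z))
        (Icc 0 1) 0 := continuousOn_const.mul (continuousOn_comp_ofReal_mul
          (differentiableOn_dslope_cutPlane hG).continuousOn hz) 0 (by simp)
    have h3 := h2.tendsto.mono_left (nhdsWithin_mono 0 Ioc_subset_Icc_self)
    rw [nhdsWithin_Ioc_eq_nhdsGT zero_lt_one] at h3
    have h4 := h1.mul h3
    rw [zero_mul] at h4
    refine h4.congr' ?_
    filter_upwards [Ioo_mem_nhdsGT (zero_lt_one' ℝ)] with t ht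
    exact (hfun t ht.1 ht.2).symm
  have hlim1 : Tendsto (fun t : ℝ => (Real.log t : ℂ) ^ (k + 1) * radialIntegral g (t * z))
      (𝓝[<] 1) (𝓝 0) := by
    have h1 : ContinuousAt (fun t : ℝ => (Real.log t : ℂ) ^ (k + 1)) 1 :=
      (continuous_ofReal.continuousAt.comp (Real.continuousAt_log one_ne_zero)).pow _
    have h2 : ContinuousWithinAt (fun t : ℝ => radialIntegral g (t * z)) (Icc 0 1) 1 :=
      continuousOn_comp_ofReal_mul hG.continuousOn hz 1 (by simp)
    have h3 := h2.tendsto.mono_left (nhdsWithin_mono 1 Ico_subset_Icc_self)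
    rw [nhdsWithin_Ico_eq_nhdsLT zero_lt_one] at h3
    simpa using (h1.tendsto.mono_left nhdsWithin_le_nhds).mul h3
  have hderiv : ∀ t ∈ Ioo (0 : ℝ) 1,
      HasDerivAt (fun t : ℝ => (Real.log t : ℂ) ^ (k + 1) * radialIntegral g (t * z))
        ((k + 1) * ((Real.log t : ℂ) ^ k * radialIntegral g (t * z) / t) +
          (Real.log t : ℂ) ^ (k + 1) * g (t * z) / t) t := by
    intro t ht
    have htz := ofReal_mul_mem_cutPlane hz ht.1.le ht.2.le
    have ht0 : (t : ℂ) ≠ 0 := by exact_mod_cast ht.1.ne'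
    have h1 : HasDerivAt (fun t : ℝ => (Real.log t : ℂ) ^ (k + 1))
        ((k + 1) * (Real.log t : ℂ) ^ k * (t : ℂ)⁻¹) t := by
      refine ((Real.hasDerivAt_log ht.1.ne').ofReal_comp.fun_pow (k + 1)).congr_deriv ?_
      simp
    have h2 : HasDerivAt (fun t : ℝ => (t : ℂ) * z) z t := by
      simpa using (hasDerivAt_id t).ofReal_comp.mul_const z
    have h3 := (hasDerivAt_radialIntegral_dslope hg h0 htz).comp_of_eq t h2 rfl
    refine (h1.mul h3).congr_deriv ?_
    rw [mul_comm (dslope g 0 _) z, ← apply_ofReal_mul_div h0 z ht.1.ne']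
    simp only [Function.comp]
    ring
  have key := integral_eq_sub_of_hasDerivAt_of_tendsto zero_lt_one hderiv
    ((hGint.const_mul _).add hgint) hlim0 hlim1
  rw [integral_add (hGint.const_mul _) hgint, intervalIntegral.integral_const_mul, sub_zero] at key
  linear_combination key

/-! ### Nielsen polylogarithms as iterated integrals -/

/-- The iterated integrals of `(-log(1-z))^p / p!` along the segment from `0` to `z`;
for `n, p ≥ 1` the values are those of Nielsen's polylogarithm `S_{n,p}`. -/
noncomputable def nielsenIter : ℕ → ℕ → ℂ → ℂ
  | 0, p, z => (-log (1 - z)) ^ p / (p.factorial : ℂ)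
  | n + 1, p, z => radialIntegral (nielsenIter n p) z

theorem nielsenIter_succ (n p : ℕ) : nielsenIter (n + 1) p = radialIntegral (nielsenIter n p) :=
  rfl

theorem hasDerivAt_log_one_sub {z : ℂ} (hz : z ∈ cutPlane) :
    HasDerivAt (fun z => log (1 - z)) (-(1 - z)⁻¹) z := by
  simpa [neg_div] using ((hasDerivAt_id z).const_sub 1).clog hz

theorem nielsenIter_zero_right {p : ℕ} (hp : p ≠ 0) (n : ℕ) : nielsenIter n p 0 = 0 := by
  induction n with
  | zero => simp [nielsenIter, hp]
  | succ n ih => exact radialIntegral_zero ih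

theorem differentiableOn_nielsenIter {p : ℕ} (hp : p ≠ 0) (n : ℕ) :
    DifferentiableOn ℂ (nielsenIter n p) cutPlane := by
  induction n with
  | zero =>
    intro z hz
    have h := (hasDerivAt_log_one_sub hz).differentiableAt
    exact ((h.neg.pow p).div_const _).differentiableWithinAt
  | succ n ih => exact differentiableOn_radialIntegral ih (nielsenIter_zero_right hp n)

theorem hasDerivAt_nielsenIter_succ {p : ℕ} (hp : p ≠ 0) (n : ℕ) {z : ℂ} (hz : z ∈ cutPlane)
    (hz0 : z ≠ 0) : HasDerivAt (nielsenIter (n + 1) p) (nielsenIter n p z / z) z :=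
  hasDerivAt_radialIntegral (differentiableOn_nielsenIter hp n) (nielsenIter_zero_right hp n) hz hz0

theorem classicalPolylog_succ_eq_nielsenIter (m : ℕ) :
    classicalPolylog (m + 1) = nielsenIter m 1 := by
  induction m with
  | zero => funext z; simp [classicalPolylog, nielsenIter]
  | succ m ih => funext z; simp [classicalPolylog, nielsenIter, radialIntegral, ih]

theorem integral_log_pow_mul_nielsenIter {p : ℕ} (hp : p ≠ 0) (m k : ℕ) {z : ℂ}
    (hz : z ∈ cutPlane) :
    ∫ t in (0 : ℝ)..1, (Real.log t : ℂ) ^ k * nielsenIter m p (t * z) / t =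
      (-1) ^ k * (k.factorial : ℂ) * nielsenIter (m + k + 1) p z := by
  induction k generalizing m with
  | zero => simp [nielsenIter, radialIntegral]
  | succ k ih =>
    rw [integral_log_pow_succ_mul (differentiableOn_nielsenIter hp m)
      (nielsenIter_zero_right hp m) hz, ← nielsenIter_succ, ih, Nat.factorial_succ,
      show m + 1 + k + 1 = m + (k + 1) + 1 by ring]
    push_cast
    ring

theorem nielsenPolylog_eq_nielsenIter {p : ℕ} (hp : p ≠ 0) (n : ℕ) {z : ℂ} (hz : z ∈ cutPlane) :
    nielsenPolylog (n + 1) p z = nielsenIter (n + 1) p z := by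
  have h := integral_log_pow_mul_nielsenIter hp 0 n hz
  have hn : (n.factorial : ℂ) ≠ 0 := by exact_mod_cast n.factorial_ne_zero
  have hp' : (p.factorial : ℂ) ≠ 0 := by exact_mod_cast p.factorial_ne_zero
  have e : ∫ t in (0 : ℝ)..1, (Real.log t : ℂ) ^ n * log (1 - z * t) ^ p / t =
      (-1) ^ p * (p.factorial : ℂ) *
        ∫ t in (0 : ℝ)..1, (Real.log t : ℂ) ^ n * nielsenIter 0 p (t * z) / t := by
    rw [← intervalIntegral.integral_const_mul]
    congr 1
    funext t
    have hs : ((-1 : ℂ) ^ p) * (-1) ^ p = 1 := by rw [← mul_pow]; simp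
    simp only [nielsenIter]
    rw [neg_pow, mul_comm (t : ℂ) z]
    field_simp
    linear_combination (-(Real.log t : ℂ) ^ n * log (1 - z * t) ^ p / t) * hs
  rw [nielsenPolylog, Nat.add_sub_cancel, e, h, zero_add, show n + 1 + p - 1 = n + p by lia]
  have hs : ((-1 : ℂ) ^ (n + p)) * ((-1) ^ p * (-1) ^ n) = 1 := by
    rw [← pow_add, ← pow_add, show n + p + (p + n) = 2 * (n + p) by ring, pow_mul]; simp
  field_simp
  linear_combination nielsenIter (n + 1) p z * hs

/-! ### Double zeta values -/

/-- The double zeta value `ζ(k, l) = ∑_{m > n ≥ 1} m⁻ᵏ n⁻ˡ`, summed over `m = i + j + 2` and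
`n = i + 1`. -/
noncomputable def doubleZeta (k l : ℕ) : ℝ :=
  ∑' q : ℕ × ℕ, 1 / (((q.1 : ℝ) + q.2 + 2) ^ k * ((q.1 : ℝ) + 1) ^ l)

/-- The real zeta value `ζ(k) = ∑_{n ≥ 1} n⁻ᵏ`. -/
noncomputable def realZeta (k : ℕ) : ℝ := ∑' n : ℕ, 1 / ((n : ℝ) + 1) ^ k

theorem summable_realZeta {k : ℕ} (hk : 2 ≤ k) : Summable fun n : ℕ => 1 / ((n : ℝ) + 1) ^ k := by
  have := (summable_nat_add_iff 1).2 (Real.summable_one_div_nat_pow.2 (show 1 < k by lia))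
  simpa using this

theorem riemannZeta_eq_realZeta {k : ℕ} (hk : 2 ≤ k) : riemannZeta k = (realZeta k : ℂ) := by
  rw [zeta_nat_eq_tsum_of_gt_one (by lia), realZeta, ofReal_tsum]
  have hs : Summable fun n : ℕ => 1 / (n : ℂ) ^ k := by
    have h := Real.summable_one_div_nat_pow.2 (show 1 < k by lia)
    simpa using (Complex.summable_ofReal (f := fun n : ℕ => 1 / (n : ℝ) ^ k)).2 h
  rw [hs.tsum_eq_zero_add]
  simp [show k ≠ 0 by lia]

/-- From `√(ab) ≤ a + b` one gets `(ab)^(3/2) ≤ ab(a+b)`, so a product of two convergent single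
series dominates. -/
theorem summable_tornheim :
    Summable fun q : ℕ × ℕ => 1 / (((q.1 : ℝ) + 1) * (q.2 + 1) * (q.1 + q.2 + 2)) := by
  have h : Summable fun n : ℕ => 1 / ((n : ℝ) + 1) ^ (3 / 2 : ℝ) := by
    have := (summable_nat_add_iff 1).2
      (Real.summable_one_div_nat_rpow.2 (show (1 : ℝ) < 3 / 2 by norm_num))
    simpa using this
  refine (h.mul_of_nonneg h (fun n => by positivity) fun n => by positivity).of_nonneg_of_le
    (fun q => by positivity) fun q => ?_
  have ha : (0 : ℝ) < q.1 + 1 := by positivity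
  have hb : (0 : ℝ) < q.2 + 1 := by positivity
  rw [one_div_mul_one_div, ← Real.mul_rpow ha.le hb.le]
  refine one_div_le_one_div_of_le (by positivity) ?_
  rw [show (3 / 2 : ℝ) = 1 + 1 / 2 by norm_num, Real.rpow_add (by positivity), Real.rpow_one,
    ← Real.sqrt_eq_rpow]
  refine mul_le_mul_of_nonneg_left ?_ (by positivity)
  rw [Real.sqrt_le_left (by positivity)]
  nlinarith

theorem summable_doubleZeta {k l : ℕ} (hk : 2 ≤ k) (hl : 1 ≤ l) :
    Summable fun q : ℕ × ℕ => 1 / (((q.1 : ℝ) + q.2 + 2) ^ k * ((q.1 : ℝ) + 1) ^ l) := by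
  refine summable_tornheim.of_nonneg_of_le (fun q => by positivity) fun q => ?_
  refine one_div_le_one_div_of_le (by positivity) ?_
  have h1 : ((q.1 : ℝ) + q.2 + 2) ^ 2 ≤ ((q.1 : ℝ) + q.2 + 2) ^ k :=
    pow_le_pow_right₀ (by linarith [q.1.cast_nonneg (α := ℝ), q.2.cast_nonneg (α := ℝ)]) hk
  have h2 : ((q.1 : ℝ) + 1) ^ 1 ≤ ((q.1 : ℝ) + 1) ^ l :=
    pow_le_pow_right₀ (by linarith [q.1.cast_nonneg (α := ℝ)]) hl
  refine le_trans ?_ (mul_le_mul h1 h2 (by positivity) (by positivity))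
  have : (0 : ℝ) ≤ (q.1 + 1) * (q.1 + q.2 + 2) * (q.1 + 1) := by positivity
  nlinarith

theorem summable_ite {ι : Type*} {F : ι → ℝ} (h : Summable F) (p : ι → Prop) [DecidablePred p] :
    Summable fun q => if p q then F q else 0 :=
  (h.indicator {q | p q}).congr fun q => by by_cases hq : p q <;> simp [hq]

/-- Pairs `i < j` are written as `j = i + d + 1`, the indexing used by `doubleZeta`. -/
theorem tsum_ite_lt_eq_tsum_add (F : ℕ → ℕ → ℝ) :
    ∑' q : ℕ × ℕ, (if q.1 < q.2 then F q.1 q.2 else 0) =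
      ∑' q : ℕ × ℕ, F q.1 (q.1 + q.2 + 1) := by
  have hinj : Function.Injective fun q : ℕ × ℕ => (q.1, q.1 + q.2 + 1) := by
    rintro ⟨a, b⟩ ⟨c, d⟩ h
    simp only [Prod.mk.injEq] at h ⊢
    lia
  rw [← hinj.tsum_eq]
  · refine tsum_congr fun q => if_pos (by simp only; lia)
  · rintro ⟨i, j⟩ h
    have hij : i < j := by
      by_contra hij
      simp [hij] at h
    exact ⟨(i, j - i - 1), by simp only [Prod.mk.injEq, true_and]; lia⟩

/-- The stuffle product: the double series splits into the two open triangles and the diagonal. -/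
theorem realZeta_mul_realZeta {k l : ℕ} (hk : 2 ≤ k) (hl : 2 ≤ l) :
    realZeta k * realZeta l = doubleZeta k l + doubleZeta l k + realZeta (k + l) := by
  have hs := (summable_realZeta hk).mul_of_nonneg (summable_realZeta hl)
    (fun n => by positivity) fun n => by positivity
  set F : ℕ → ℕ → ℝ := fun i j => 1 / ((i : ℝ) + 1) ^ k * (1 / ((j : ℝ) + 1) ^ l) with hF
  have hs' : Summable fun q : ℕ × ℕ => F q.1 q.2 := hs
  have h1 : Summable fun q : ℕ × ℕ => if q.1 < q.2 then F q.1 q.2 else 0 :=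
    summable_ite hs' fun q => q.1 < q.2
  have h2 : Summable fun q : ℕ × ℕ => if q.2 < q.1 then F q.1 q.2 else 0 :=
    summable_ite hs' fun q => q.2 < q.1
  have h3 : Summable fun q : ℕ × ℕ => if q.1 = q.2 then F q.1 q.2 else 0 :=
    summable_ite hs' fun q => q.1 = q.2
  have hsplit : ∀ q : ℕ × ℕ, F q.1 q.2 = ((if q.1 < q.2 then F q.1 q.2 else 0) +
      (if q.2 < q.1 then F q.1 q.2 else 0)) + (if q.1 = q.2 then F q.1 q.2 else 0) := by
    intro q
    rcases lt_trichotomy q.1 q.2 with h | h | h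
    · simp [h, h.not_gt, h.ne]
    · simp [h]
    · simp [h, h.not_gt, h.ne']
  have e1 : ∑' q : ℕ × ℕ, (if q.1 < q.2 then F q.1 q.2 else 0) = doubleZeta l k := by
    rw [tsum_ite_lt_eq_tsum_add]
    refine tsum_congr fun q => ?_
    simp only [hF]
    push_cast
    rw [one_div_mul_one_div, mul_comm]
    ring_nf
  have e2 : ∑' q : ℕ × ℕ, (if q.2 < q.1 then F q.1 q.2 else 0) = doubleZeta k l := by
    rw [← (Equiv.prodComm ℕ ℕ).tsum_eq]
    refine (tsum_ite_lt_eq_tsum_add fun i j => F j i).trans ?_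
    refine tsum_congr fun q => ?_
    simp only [hF]
    push_cast
    rw [one_div_mul_one_div]
    ring_nf
  have e3 : ∑' q : ℕ × ℕ, (if q.1 = q.2 then F q.1 q.2 else 0) = realZeta (k + l) := by
    have hinj : Function.Injective fun n : ℕ => (n, n) := fun a b h => congrArg Prod.fst h
    rw [← hinj.tsum_eq]
    · refine tsum_congr fun n => ?_
      simp only [hF, if_true]
      rw [one_div_mul_one_div, pow_add]
    · rintro ⟨i, j⟩ h
      have hij : i = j := by
        by_contra hij
        simp [hij] at h
      exact ⟨i, by simp [hij]⟩
  rw [realZeta, realZeta, (summable_realZeta hk).tsum_mul_tsum (summable_realZeta hl) hs,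
    tsum_congr hsplit, (h1.add h2).tsum_add h3, h1.tsum_add h2, e1, e2, e3]
  ring

/-- Raising the shift `a` by one adds a telescoping series with sum `1/(a+1)`. -/
theorem hasSum_one_div_sub_one_div_add (a : ℕ) :
    HasSum (fun j : ℕ => 1 / ((j : ℝ) + 1) - 1 / ((j : ℝ) + 1 + a))
      (∑ c ∈ Finset.range a, 1 / ((c : ℝ) + 1)) := by
  induction a with
  | zero => simp
  | succ a ih =>
    have h : HasSum (fun j : ℕ => 1 / ((j : ℝ) + 1 + a) - 1 / (((j + 1 : ℕ) : ℝ) + 1 + a))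
        (1 / ((a : ℝ) + 1)) := by
      rw [hasSum_iff_tendsto_nat_of_nonneg]
      · simp_rw [Finset.sum_range_sub' fun j : ℕ => 1 / ((j : ℝ) + 1 + a)]
        have : Tendsto (fun n : ℕ => 1 / ((n : ℝ) + 1 + a)) atTop (𝓝 0) := by
          have := (tendsto_one_div_add_atTop_nhds_zero_nat (𝕜 := ℝ)).comp (tendsto_add_atTop_nat a)
          refine this.congr fun n => ?_
          simp only [Function.comp]
          push_cast
          ring_nf
        simpa [add_comm] using (tendsto_const_nhds (x := 1 / ((a : ℝ) + 1))).sub this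
      · intro j
        rw [sub_nonneg]
        refine one_div_le_one_div_of_le (by positivity) ?_
        push_cast
        linarith
    rw [Finset.sum_range_succ]
    refine (ih.add h).congr_fun fun j => ?_
    push_cast
    ring

/-- With `a = i + 1`, summing over `j` first turns `1/(b(a+b))` into `H_a/a`. In this harmonic
number the term `c = a` yields the single zeta value and the terms `c < a` yield the double one. -/
theorem tsum_tornheim_eq {r : ℕ} (hr : 1 ≤ r) :
    ∑' q : ℕ × ℕ, 1 / (((q.1 : ℝ) + 1) ^ r * (q.2 + 1) * (q.1 + q.2 + 2)) =
      realZeta (r + 2) + doubleZeta (r + 1) 1 := by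
  have hs : Summable fun q : ℕ × ℕ =>
      1 / (((q.1 : ℝ) + 1) ^ r * (q.2 + 1) * (q.1 + q.2 + 2)) := by
    refine summable_tornheim.of_nonneg_of_le (fun q => by positivity) fun q => ?_
    refine one_div_le_one_div_of_le (by positivity) ?_
    have : ((q.1 : ℝ) + 1) ^ 1 ≤ ((q.1 : ℝ) + 1) ^ r :=
      pow_le_pow_right₀ (by linarith [q.1.cast_nonneg (α := ℝ)]) hr
    rw [pow_one] at this
    gcongr
  have hfib : ∀ i : ℕ, ∑' j : ℕ, 1 / (((i : ℝ) + 1) ^ r * (j + 1) * (i + j + 2)) =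
      1 / ((i : ℝ) + 1) ^ (r + 2) +
        ∑ c ∈ Finset.range i, 1 / (((i : ℝ) + 1) ^ (r + 1) * ((c : ℝ) + 1)) := by
    intro i
    have h := (hasSum_one_div_sub_one_div_add (i + 1)).mul_left (1 / ((i : ℝ) + 1) ^ (r + 1))
    rw [Finset.sum_range_succ, mul_add, Finset.mul_sum] at h
    refine (HasSum.tsum_eq (h.congr_fun fun j => ?_)).trans ?_
    · push_cast
      field_simp
      ring
    · rw [add_comm]
      congr 1
      · field_simp
        ring
      · refine Finset.sum_congr rfl fun c _ => ?_
        field_simp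
  have hinj : Function.Injective fun q : ℕ × ℕ => (q.1, q.1 + q.2 + 1) := by
    rintro ⟨a, b⟩ ⟨c, d⟩ h
    simp only [Prod.mk.injEq] at h ⊢
    lia
  have hD : Summable fun q : ℕ × ℕ =>
      if q.1 < q.2 then 1 / (((q.2 : ℝ) + 1) ^ (r + 1) * ((q.1 : ℝ) + 1)) else 0 := by
    rw [← hinj.summable_iff]
    · refine (summable_doubleZeta (show 2 ≤ r + 1 by lia) le_rfl).congr fun q => ?_
      simp only [Function.comp]
      rw [if_pos (by lia), pow_one]
      push_cast
      ring_nf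
    · rintro ⟨i, j⟩ h
      refine if_neg fun hij => h ⟨(i, j - i - 1), ?_⟩
      simp only [Prod.mk.injEq, true_and] at hij ⊢
      lia
  have hfin : ∀ i : ℕ, ∑ c ∈ Finset.range i, 1 / (((i : ℝ) + 1) ^ (r + 1) * ((c : ℝ) + 1)) =
      ∑' c : ℕ, if c < i then 1 / (((i : ℝ) + 1) ^ (r + 1) * ((c : ℝ) + 1)) else 0 := by
    intro i
    rw [tsum_eq_sum (s := Finset.range i) fun c hc => if_neg (by simpa using hc)]
    exact Finset.sum_congr rfl fun c hc => (if_pos (Finset.mem_range.1 hc)).symm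
  have hDsum : ∑' i : ℕ, ∑ c ∈ Finset.range i, 1 / (((i : ℝ) + 1) ^ (r + 1) * ((c : ℝ) + 1)) =
      doubleZeta (r + 1) 1 := by
    rw [tsum_congr hfin]
    refine hD.prod_symm.tsum_prod.symm.trans ?_
    rw [← (Equiv.prodComm ℕ ℕ).tsum_eq]
    refine (tsum_ite_lt_eq_tsum_add
      fun i j => 1 / (((j : ℝ) + 1) ^ (r + 1) * ((i : ℝ) + 1))).trans ?_
    refine tsum_congr fun q => ?_
    push_cast
    ring_nf
  have hDs : Summable fun i : ℕ =>
      ∑ c ∈ Finset.range i, 1 / (((i : ℝ) + 1) ^ (r + 1) * ((c : ℝ) + 1)) :=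
    (hD.prod_symm.prod).congr fun i => (hfin i).symm
  rw [hs.tsum_prod, tsum_congr hfib, (summable_realZeta (by lia)).tsum_add hDs, hDsum, realZeta]

theorem tsum_tornheim_swap {k : ℕ} :
    ∑' q : ℕ × ℕ, 1 / (((q.1 : ℝ) + q.2 + 2) ^ k * ((q.2 : ℝ) + 1)) = doubleZeta k 1 := by
  rw [doubleZeta, ← (Equiv.prodComm ℕ ℕ).tsum_eq]
  refine tsum_congr fun q => ?_
  simp only [Equiv.prodComm_apply, Prod.fst_swap, Prod.snd_swap, pow_one]
  ring_nf

theorem summable_tornheim_swap {k : ℕ} (hk : 2 ≤ k) :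
    Summable fun q : ℕ × ℕ => 1 / (((q.1 : ℝ) + q.2 + 2) ^ k * ((q.2 : ℝ) + 1)) :=
  (summable_doubleZeta hk le_rfl).prod_symm.congr fun q => by
    simp only [Prod.fst_swap, Prod.snd_swap, pow_one]
    ring_nf

/-- Euler's sum formula for double zeta values. -/
theorem sum_doubleZeta {r : ℕ} (hr : 1 ≤ r) :
    ∑ k ∈ Finset.range r, doubleZeta (k + 2) (r - k) = realZeta (r + 2) := by
  -- Partial fractions of `1/(a^r b (a+b))` with respect to `a + b`. Summed over all pairs, the last
  -- term gives `ζ(r+1,1)`, which cancels the same value in `tsum_tornheim_eq`.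
  have hpf : ∀ q : ℕ × ℕ, (∑ k ∈ Finset.range r,
      1 / (((q.1 : ℝ) + q.2 + 2) ^ (k + 2) * ((q.1 : ℝ) + 1) ^ (r - k))) +
        1 / (((q.1 : ℝ) + q.2 + 2) ^ (r + 1) * ((q.2 : ℝ) + 1)) =
      1 / (((q.1 : ℝ) + 1) ^ r * (q.2 + 1) * (q.1 + q.2 + 2)) := by
    intro q
    have key : ∀ a b : ℝ, 0 < a → 0 < b → (∑ k ∈ Finset.range r,
        1 / ((a + b) ^ (k + 2) * a ^ (r - k))) + 1 / ((a + b) ^ (r + 1) * b) =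
          1 / (a ^ r * b * (a + b)) := by
      intro a b ha hb
      clear hr
      induction r with
      | zero => simp; ring
      | succ r ih =>
        have e : ∀ k ∈ Finset.range r, 1 / ((a + b) ^ (k + 2) * a ^ (r + 1 - k)) =
            1 / a * (1 / ((a + b) ^ (k + 2) * a ^ (r - k))) := by
          intro k hk
          rw [Nat.succ_sub (Finset.mem_range.1 hk).le, Nat.succ_eq_add_one,
            pow_succ a (r - k)]
          field_simp
        rw [Finset.sum_range_succ, Finset.sum_congr rfl e, ← Finset.mul_sum,
          eq_sub_of_add_eq ih, Nat.add_sub_cancel_left]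
        have : 0 < a + b := by positivity
        field_simp
        ring
    have := key (q.1 + 1) (q.2 + 1) (by positivity) (by positivity)
    rw [show (q.1 : ℝ) + 1 + (q.2 + 1) = q.1 + q.2 + 2 by ring] at this
    exact this
  have hterm : ∀ k ∈ Finset.range r, Summable fun q : ℕ × ℕ =>
      1 / (((q.1 : ℝ) + q.2 + 2) ^ (k + 2) * ((q.1 : ℝ) + 1) ^ (r - k)) := fun k hk =>
    summable_doubleZeta (by lia) (by have := Finset.mem_range.1 hk; lia)
  have h := tsum_tornheim_eq hr
  rw [← tsum_congr hpf, (summable_sum hterm).tsum_add (summable_tornheim_swap (by lia)),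
    tsum_tornheim_swap, Summable.tsum_finsetSum hterm] at h
  simpa [doubleZeta] using h

theorem realZeta_two : realZeta 2 = Real.pi ^ 2 / 6 := by
  have h := riemannZeta_eq_realZeta (k := 2) le_rfl
  rw [Nat.cast_ofNat, riemannZeta_two] at h
  exact_mod_cast h.symm

theorem realZeta_four : realZeta 4 = Real.pi ^ 4 / 90 := by
  have h := riemannZeta_eq_realZeta (k := 4) (by norm_num)
  rw [Nat.cast_ofNat, riemannZeta_four] at h
  exact_mod_cast h.symm

theorem bernoulli_six : bernoulli 6 = 1 / 42 := by
  rw [bernoulli_eq_bernoulli'_of_ne_one (by norm_num), bernoulli'_def]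
  have h5 : bernoulli' 5 = 0 := bernoulli'_eq_zero_of_odd (by decide) (by norm_num)
  simp [Finset.sum_range_succ, h5, Nat.choose]
  norm_num

theorem realZeta_six : realZeta 6 = Real.pi ^ 6 / 945 := by
  have h := riemannZeta_eq_realZeta (k := 6) (by norm_num)
  have h2 := riemannZeta_two_mul_nat (k := 3) (by norm_num)
  norm_num [bernoulli_six, Nat.factorial] at h h2
  rw [h] at h2
  have h3 : (realZeta 6 : ℂ) = ((Real.pi ^ 6 / 945 : ℝ) : ℂ) := by
    rw [h2]
    push_cast
    ring
  exact_mod_cast h3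

theorem doubleZeta_two_one : doubleZeta 2 1 = realZeta 3 := by
  simpa using sum_doubleZeta (r := 1) le_rfl

theorem doubleZeta_three_one : doubleZeta 3 1 = realZeta 4 / 4 := by
  have h := sum_doubleZeta (r := 2) (by norm_num)
  have h2 := realZeta_mul_realZeta (k := 2) (l := 2) le_rfl le_rfl
  norm_num [Finset.sum_range_succ] at h h2
  rw [realZeta_two] at h2
  rw [realZeta_four] at *
  linarith

theorem doubleZeta_four_one : doubleZeta 4 1 = 2 * realZeta 5 - realZeta 2 * realZeta 3 := by
  have h := sum_doubleZeta (r := 3) (by norm_num)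
  have h2 := realZeta_mul_realZeta (k := 2) (l := 3) le_rfl (by norm_num)
  norm_num [Finset.sum_range_succ] at h h2
  linarith

/-- In the sum formula of weight 6, the stuffle of `ζ(2)ζ(4)` removes `ζ(2,4) + ζ(4,2)` and that of
`ζ(3)^2` removes `ζ(3,3)`; the powers of `π` turn `ζ(2)ζ(4)` into `7/4 ζ(6)`. -/
theorem doubleZeta_five_one : doubleZeta 5 1 = 3 / 4 * realZeta 6 - realZeta 3 ^ 2 / 2 := by
  have h := sum_doubleZeta (r := 4) (by norm_num)
  have h2 := realZeta_mul_realZeta (k := 2) (l := 4) le_rfl (by norm_num)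
  have h3 := realZeta_mul_realZeta (k := 3) (l := 3) (by norm_num) (by norm_num)
  norm_num [Finset.sum_range_succ] at h h2 h3
  rw [realZeta_two, realZeta_four] at h2
  rw [realZeta_six] at *
  linarith

/-! ### Power series and limits at 1 -/

theorem hasSum_radialIntegral {ι : Type*} [Countable ι] {g : ℂ → ℂ} {c : ι → ℂ} {e : ι → ℕ}
    (hg : ∀ w : ℂ, ‖w‖ < 1 → HasSum (fun i => c i * w ^ (e i + 1)) (g w)) {z : ℂ} (hz : ‖z‖ < 1) :
    HasSum (fun i => c i / (e i + 1) * z ^ (e i + 1)) (radialIntegral g z) := by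
  have hF : ∀ i, ∫ t in (0 : ℝ)..1, c i * z ^ (e i + 1) * (t : ℂ) ^ e i =
      c i / (e i + 1) * z ^ (e i + 1) := by
    intro i
    have h : ∫ t in (0 : ℝ)..1, (t : ℂ) ^ e i = 1 / (e i + 1) := by
      have := integral_pow (a := 0) (b := 1) (e i)
      simp only [← ofReal_pow]
      rw [intervalIntegral.integral_ofReal, this]
      simp
    rw [intervalIntegral.integral_const_mul, h]
    ring
  simp only [← hF]
  refine intervalIntegral.hasSum_integral_of_dominated_convergence
    (bound := fun i _ => ‖c i * z ^ (e i + 1)‖) (fun i => by fun_prop) ?_ ?_ ?_ ?_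
  · refine fun i => ae_of_all _ fun t ht => ?_
    rw [uIoc_of_le zero_le_one] at ht
    rw [norm_mul _ ((t : ℂ) ^ e i), norm_pow (t : ℂ), norm_real, Real.norm_of_nonneg ht.1.le]
    exact mul_le_of_le_one_right (norm_nonneg _) (pow_le_one₀ ht.1.le ht.2)
  · exact ae_of_all _ fun t _ => (hg z hz).summable.norm
  · exact intervalIntegrable_const
  · refine ae_of_all _ fun t ht => ?_
    rw [uIoc_of_le zero_le_one] at ht
    have ht0 : (t : ℂ) ≠ 0 := by exact_mod_cast ht.1.ne'
    have hn : ‖(t : ℂ) * z‖ < 1 := by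
      rw [norm_mul, norm_real, Real.norm_of_nonneg ht.1.le]
      exact (mul_le_of_le_one_left (norm_nonneg z) ht.2).trans_lt hz
    refine ((hg _ hn).div_const (t : ℂ)).congr_fun fun i => ?_
    rw [mul_pow, pow_succ (t : ℂ)]
    field_simp

theorem hasSum_nielsenIter_one (n : ℕ) {z : ℂ} (hz : ‖z‖ < 1) :
    HasSum (fun k : ℕ => 1 / ((k : ℂ) + 1) ^ (n + 1) * z ^ (k + 1)) (nielsenIter n 1 z) := by
  induction n generalizing z with
  | zero =>
    simpa [nielsenIter, div_eq_mul_inv, mul_comm] using hasSum_taylorSeries_neg_log' hz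
  | succ n ih =>
    refine (hasSum_radialIntegral (fun w hw => ih hw) hz).congr_fun fun k => ?_
    rw [div_div, ← pow_succ]

theorem norm_one_div_mul_add_le_one (i j : ℕ) :
    ‖1 / (((i : ℂ) + 1) * (i + j + 2))‖ ≤ 1 := by
  have : 1 / (((i : ℂ) + 1) * (i + j + 2)) =
      ((1 / (((i : ℝ) + 1) * (i + j + 2)) : ℝ) : ℂ) := by push_cast; ring
  rw [this, norm_real, Real.norm_of_nonneg (by positivity), div_le_one (by positivity)]
  have h1 := i.cast_nonneg (α := ℝ)
  have h2 := j.cast_nonneg (α := ℝ)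
  nlinarith

theorem summable_log_sq {z : ℂ} (hz : ‖z‖ < 1) :
    Summable fun q : ℕ × ℕ =>
      1 / (((q.1 : ℂ) + 1) * (q.1 + q.2 + 2)) * z ^ (q.1 + q.2 + 1 + 1) := by
  have hgeom := (summable_geometric_of_lt_one (norm_nonneg z) hz).norm
  refine Summable.of_norm_bounded (summable_mul_of_summable_norm hgeom hgeom) fun q => ?_
  rw [norm_mul, norm_pow, ← pow_add]
  refine (mul_le_of_le_one_left (by positivity) (norm_one_div_mul_add_le_one q.1 q.2)).trans ?_
  exact pow_le_pow_of_le_one (norm_nonneg z) hz.le (by lia)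

theorem one_div_mul_eq_add (z : ℂ) (i j : ℕ) :
    z ^ (i + 1) / (i + 1) * (z ^ (j + 1) / (j + 1)) =
      1 / (((i : ℂ) + 1) * (i + j + 2)) * z ^ (i + j + 1 + 1) +
        1 / (((j : ℂ) + 1) * (j + i + 2)) * z ^ (j + i + 1 + 1) := by
  have e1 : (i : ℂ) + 1 ≠ 0 := by exact_mod_cast i.succ_ne_zero
  have e2 : (j : ℂ) + 1 ≠ 0 := by exact_mod_cast j.succ_ne_zero
  have e3 : (i : ℂ) + j + 2 ≠ 0 := by exact_mod_cast (i + j + 1).succ_ne_zero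
  rw [add_comm (j : ℂ) i, add_comm j i, show z ^ (i + 1) / (i + 1) * (z ^ (j + 1) / (j + 1)) =
    1 / (((i : ℂ) + 1) * (j + 1)) * z ^ (i + j + 1 + 1) by
      field_simp
      ring, ← add_mul]
  congr 1
  field_simp
  ring

/-- Symmetrisation: `F` and its transpose have equal sums, and together they make up the product
series of `s^2`. -/
theorem HasSum.sq_div_two {u : ℕ → ℂ} {s : ℂ} (hu : HasSum u s) {F : ℕ × ℕ → ℂ}
    (hF : Summable F) (h : ∀ i j, u i * u j = F (i, j) + F (j, i)) : HasSum F (s ^ 2 / 2) := by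
  have hprod := hu.mul hu (summable_mul_of_summable_norm hu.summable.norm hu.summable.norm)
  have hswap : HasSum (fun q : ℕ × ℕ => F q.swap) (∑' q, F q) :=
    (Equiv.prodComm ℕ ℕ).hasSum_iff.2 hF.hasSum
  have h2 := (hprod.congr_fun fun q => (h q.1 q.2).symm).unique (hF.hasSum.add hswap)
  rw [show s ^ 2 / 2 = ∑' q, F q by linear_combination h2 / 2]
  exact hF.hasSum

theorem hasSum_log_sq {z : ℂ} (hz : ‖z‖ < 1) :
    HasSum (fun q : ℕ × ℕ => 1 / (((q.1 : ℂ) + 1) * (q.1 + q.2 + 2)) * z ^ (q.1 + q.2 + 1 + 1))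
      ((-log (1 - z)) ^ 2 / 2) :=
  (hasSum_taylorSeries_neg_log' hz).sq_div_two (summable_log_sq hz) (one_div_mul_eq_add z)

theorem hasSum_nielsenIter_two (n : ℕ) {z : ℂ} (hz : ‖z‖ < 1) :
    HasSum (fun q : ℕ × ℕ => 1 / (((q.1 : ℂ) + 1) * (q.1 + q.2 + 2) ^ (n + 1)) *
      z ^ (q.1 + q.2 + 1 + 1)) (nielsenIter n 2 z) := by
  induction n generalizing z with
  | zero => simpa [nielsenIter] using hasSum_log_sq hz
  | succ n ih =>
    refine (hasSum_radialIntegral (fun w hw => ih hw) hz).congr_fun fun q => ?_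
    rw [div_div, pow_succ _ (n + 1)]
    push_cast
    ring_nf

/-- The coefficients are absolutely summable, so dominated convergence gives the radial limit at 1.
-/
theorem tendsto_apply_one_sub {ι : Type*} {g : ℂ → ℂ} {c : ι → ℂ} {e : ι → ℕ}
    (hc : Summable fun i => ‖c i‖)
    (hg : ∀ w : ℂ, ‖w‖ < 1 → HasSum (fun i => c i * w ^ (e i + 1)) (g w)) :
    Tendsto (fun x : ℝ => g (1 - x)) (𝓝[>] 0) (𝓝 (∑' i, c i)) := by
  have hev : ∀ᶠ x : ℝ in 𝓝[>] 0, ‖(1 : ℂ) - x‖ < 1 := by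
    filter_upwards [Ioo_mem_nhdsGT (zero_lt_one' ℝ)] with x hx
    rw [← ofReal_one, ← ofReal_sub, norm_real, Real.norm_of_nonneg (by linarith [hx.2])]
    linarith [hx.1]
  have h : Tendsto (fun x : ℝ => ∑' i, c i * ((1 : ℂ) - x) ^ (e i + 1)) (𝓝[>] 0)
      (𝓝 (∑' i, c i)) := by
    refine tendsto_tsum_of_dominated_convergence hc (fun i => ?_) ?_
    · have : Continuous fun x : ℝ => c i * ((1 : ℂ) - x) ^ (e i + 1) := by fun_prop
      simpa using (this.tendsto 0).mono_left nhdsWithin_le_nhds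
    · filter_upwards [hev] with x hx i
      rw [norm_mul, norm_pow]
      exact mul_le_of_le_one_right (norm_nonneg _) (pow_le_one₀ (norm_nonneg _) hx.le)
  refine h.congr' ?_
  filter_upwards [hev] with x hx
  exact (hg _ hx).tsum_eq

theorem tendsto_nielsenIter_one {n : ℕ} (hn : 1 ≤ n) :
    Tendsto (fun x : ℝ => nielsenIter n 1 (1 - x)) (𝓝[>] 0) (𝓝 (realZeta (n + 1))) := by
  have h := tendsto_apply_one_sub (e := id)
    (c := fun k : ℕ => ((1 / ((k : ℝ) + 1) ^ (n + 1) : ℝ) : ℂ))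
    (g := nielsenIter n 1) ?_ fun w hw => by simpa using hasSum_nielsenIter_one n hw
  · rwa [← ofReal_tsum] at h
  · simp_rw [norm_real]
    exact (summable_realZeta (by lia)).norm

theorem tendsto_nielsenIter_two {n : ℕ} (hn : 1 ≤ n) :
    Tendsto (fun x : ℝ => nielsenIter n 2 (1 - x)) (𝓝[>] 0) (𝓝 (doubleZeta (n + 1) 1)) := by
  have h := tendsto_apply_one_sub (e := fun q : ℕ × ℕ => q.1 + q.2 + 1)
    (c := fun q : ℕ × ℕ => ((1 / (((q.1 : ℝ) + q.2 + 2) ^ (n + 1) * ((q.1 : ℝ) + 1) ^ 1) : ℝ) : ℂ))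
    (g := nielsenIter n 2) ?_ fun w hw => by
      refine (hasSum_nielsenIter_two n hw).congr_fun fun q => ?_
      push_cast
      ring_nf
  · rwa [← ofReal_tsum] at h
  · simp_rw [norm_real]
    exact (summable_doubleZeta (by lia) le_rfl).norm

/-! ### Changes of variable, derivatives and limits at 0 -/

theorem one_sub_div_sub_one {z : ℂ} (hz : z ∈ doublyCutPlane) : 1 - z / (z - 1) = (1 - z)⁻¹ := by
  have h1 : 1 - z ≠ 0 := slitPlane_ne_zero hz.2
  have h2 : z - 1 ≠ 0 := fun h => h1 (by linear_combination -h)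
  field_simp
  ring

theorem div_sub_one_mem_cutPlane {z : ℂ} (hz : z ∈ doublyCutPlane) : z / (z - 1) ∈ cutPlane := by
  have h1 : 1 - z ≠ 0 := slitPlane_ne_zero hz.2
  have harg := slitPlane_arg_ne_pi hz.2
  refine mem_slitPlane_iff_arg.2 ?_
  rw [one_sub_div_sub_one hz]
  refine ⟨?_, inv_ne_zero h1⟩
  rw [arg_inv, if_neg harg]
  have := neg_pi_lt_arg (1 - z)
  intro h
  linarith

theorem one_sub_mem_cutPlane {z : ℂ} (hz : z ∈ doublyCutPlane) : 1 - z ∈ cutPlane := by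
  simpa [cutPlane] using hz.1

theorem log_one_sub_div_sub_one {z : ℂ} (hz : z ∈ doublyCutPlane) :
    log (1 - z / (z - 1)) = -log (1 - z) := by
  rw [one_sub_div_sub_one hz, log_inv _ (slitPlane_arg_ne_pi hz.2)]

theorem ofReal_mem_doublyCutPlane {x : ℝ} (hx : x ∈ Ioo (0 : ℝ) 1) :
    (x : ℂ) ∈ doublyCutPlane :=
  ⟨Or.inl (by simpa using hx.1), Or.inl (by simpa using hx.2)⟩

/-- The difference is constant on a connected open set. The point 0 lies on its boundary, so the
constant is read off from limits along the positive reals. -/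
theorem eq_of_hasDerivAt_of_tendsto {f g f' : ℂ → ℂ} {c : ℂ}
    (hf : ∀ z ∈ doublyCutPlane, HasDerivAt f (f' z) z)
    (hg : ∀ z ∈ doublyCutPlane, HasDerivAt g (f' z) z)
    (hfc : Tendsto (fun x : ℝ => f x) (𝓝[>] 0) (𝓝 c))
    (hgc : Tendsto (fun x : ℝ => g x) (𝓝[>] 0) (𝓝 c)) :
    ∀ z ∈ doublyCutPlane, f z = g z := by
  obtain ⟨a, ha⟩ := isOpen_doublyCutPlane.exists_eq_add_of_deriv_eq doublyCutPlane_isPreconnected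
    (fun z hz => (hf z hz).differentiableAt.differentiableWithinAt)
    (fun z hz => (hg z hz).differentiableAt.differentiableWithinAt)
    (fun z hz => (hf z hz).deriv.trans (hg z hz).deriv.symm)
  have hfa : Tendsto (fun x : ℝ => f x) (𝓝[>] 0) (𝓝 (c + a)) := by
    refine (hgc.add_const a).congr' ?_
    filter_upwards [Ioo_mem_nhdsGT (zero_lt_one' ℝ)] with x hx
    exact (ha (ofReal_mem_doublyCutPlane hx)).symm
  have h0 : a = 0 := by
    have := tendsto_nhds_unique hfc hfa
    linear_combination -this
  intro z hz
  simpa [h0] using ha hz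

theorem hasDerivAt_nielsenIter_div_sub_one {p : ℕ} (hp : p ≠ 0) (n : ℕ) {z : ℂ}
    (hz : z ∈ doublyCutPlane) :
    HasDerivAt (fun z => nielsenIter (n + 1) p (z / (z - 1)))
      (nielsenIter n p (z / (z - 1)) * (1 / z + 1 / (1 - z))) z := by
  have h0 : z ≠ 0 := slitPlane_ne_zero hz.1
  have h1 : 1 - z ≠ 0 := slitPlane_ne_zero hz.2
  have h2 : z - 1 ≠ 0 := fun h => h1 (by linear_combination -h)
  have h := (hasDerivAt_id z).fun_div ((hasDerivAt_id z).sub_const 1) h2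
  refine ((hasDerivAt_nielsenIter_succ hp n (div_sub_one_mem_cutPlane hz)
    (div_ne_zero h0 h2)).comp z h).congr_deriv ?_
  simp only [id]
  field_simp
  ring

theorem hasDerivAt_nielsenIter_one_sub {p : ℕ} (hp : p ≠ 0) (n : ℕ) {z : ℂ}
    (hz : z ∈ doublyCutPlane) :
    HasDerivAt (fun z => nielsenIter (n + 1) p (1 - z)) (-nielsenIter n p (1 - z) / (1 - z)) z := by
  have h1 : 1 - z ≠ 0 := slitPlane_ne_zero hz.2
  refine ((hasDerivAt_nielsenIter_succ hp n (one_sub_mem_cutPlane hz) h1).comp z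
    ((hasDerivAt_id z).const_sub 1)).congr_deriv ?_
  ring

theorem continuousAt_nielsenIter_zero {p : ℕ} (hp : p ≠ 0) (n : ℕ) :
    ContinuousAt (nielsenIter n p) 0 :=
  ((differentiableOn_nielsenIter hp n).differentiableAt
    (cutPlane_mem_nhds zero_mem_cutPlane)).continuousAt

theorem tendsto_ofReal_nhdsGT_zero : Tendsto (fun x : ℝ => (x : ℂ)) (𝓝[>] 0) (𝓝 0) := by
  simpa using (continuous_ofReal.tendsto 0).mono_left nhdsWithin_le_nhds

theorem tendsto_nielsenIter_nhdsGT_zero {p : ℕ} (hp : p ≠ 0) (n : ℕ) :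
    Tendsto (fun x : ℝ => nielsenIter n p x) (𝓝[>] 0) (𝓝 0) := by
  have h := (continuousAt_nielsenIter_zero hp n).tendsto
  rw [nielsenIter_zero_right hp] at h
  exact h.comp tendsto_ofReal_nhdsGT_zero

theorem tendsto_nielsenIter_div_sub_one {p : ℕ} (hp : p ≠ 0) (n : ℕ) :
    Tendsto (fun x : ℝ => nielsenIter n p (x / (x - 1))) (𝓝[>] 0) (𝓝 0) := by
  have h := (continuousAt_nielsenIter_zero hp n).tendsto
  rw [nielsenIter_zero_right hp] at h
  refine h.comp ?_
  simpa [Pi.div_def] using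
    tendsto_ofReal_nhdsGT_zero.div (tendsto_ofReal_nhdsGT_zero.sub_const 1) (by simp)

/-- A zero of `g` at 0 contributes a factor `x`, which outweighs every power of `log x`. -/
theorem tendsto_log_pow_mul {g : ℂ → ℂ} (hg : DifferentiableAt ℂ g 0) (h0 : g 0 = 0) (k : ℕ) :
    Tendsto (fun x : ℝ => log (x : ℂ) ^ k * g x) (𝓝[>] 0) (𝓝 0) := by
  have h1 := (continuous_ofReal.tendsto 0).comp (tendsto_pow_log_mul_self k)
  have h2 := (continuousAt_dslope_same.2 hg).tendsto.comp tendsto_ofReal_nhdsGT_zero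
  have h3 := h1.mul h2
  rw [ofReal_zero, zero_mul] at h3
  refine h3.congr' ?_
  filter_upwards [self_mem_nhdsWithin] with x hx
  have hx : 0 < x := hx
  have h := sub_smul_dslope g 0 (x : ℂ)
  simp only [sub_zero, smul_eq_mul, h0] at h
  simp only [Function.comp]
  rw [← h, ofReal_mul, ofReal_pow, ofReal_log hx.le]
  ring

theorem tendsto_log_pow_mul_nielsenIter {p : ℕ} (hp : p ≠ 0) (n k : ℕ) :
    Tendsto (fun x : ℝ => log (x : ℂ) ^ k * nielsenIter n p x) (𝓝[>] 0) (𝓝 0) :=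
  tendsto_log_pow_mul ((differentiableOn_nielsenIter hp n).differentiableAt
    (cutPlane_mem_nhds zero_mem_cutPlane)) (nielsenIter_zero_right hp n) k

theorem tendsto_log_pow_mul_log_one_sub (k : ℕ) :
    Tendsto (fun x : ℝ => log (x : ℂ) ^ k * log (1 - x)) (𝓝[>] 0) (𝓝 0) :=
  tendsto_log_pow_mul (g := fun z => log (1 - z))
    (hasDerivAt_log_one_sub zero_mem_cutPlane).differentiableAt (by simp) k

theorem tendsto_log_one_sub_nhdsGT_zero :
    Tendsto (fun x : ℝ => log (1 - (x : ℂ))) (𝓝[>] 0) (𝓝 0) := by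
  simpa using tendsto_log_pow_mul_log_one_sub 0

theorem nielsenIter_zero_left (p : ℕ) (z : ℂ) :
    nielsenIter 0 p z = (-log (1 - z)) ^ p / (p.factorial : ℂ) :=
  rfl

theorem nielsenIter_zero_div_sub_one (p : ℕ) {z : ℂ} (hz : z ∈ doublyCutPlane) :
    nielsenIter 0 p (z / (z - 1)) = log (1 - z) ^ p / (p.factorial : ℂ) := by
  rw [nielsenIter_zero_left, log_one_sub_div_sub_one hz, neg_neg]

theorem nielsenIter_zero_one_sub (p : ℕ) (z : ℂ) :
    nielsenIter 0 p (1 - z) = (-log z) ^ p / (p.factorial : ℂ) := by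
  rw [nielsenIter_zero_left, sub_sub_cancel]

theorem hasDerivAt_pow_succ_div_factorial {e : ℂ → ℂ} {e' z : ℂ} (he : HasDerivAt e e' z) (j : ℕ) :
    HasDerivAt (fun z => e z ^ (j + 1) / ((j + 1).factorial : ℂ))
      (e z ^ j / (j.factorial : ℂ) * e') z := by
  have h1 : (j.factorial : ℂ) ≠ 0 := by exact_mod_cast j.factorial_ne_zero
  have h2 : (j : ℂ) + 1 ≠ 0 := by exact_mod_cast j.succ_ne_zero
  refine ((he.fun_pow (j + 1)).div_const _).congr_deriv ?_
  rw [Nat.factorial_succ]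
  push_cast
  field_simp

/-- The derivative of the truncated exponential convolution `∑ eʲ / j! * U (n - j)`. -/
theorem hasDerivAt_sum_pow_div_factorial_mul {e : ℂ → ℂ} {e' z : ℂ} {U : ℕ → ℂ → ℂ} {V : ℕ → ℂ}
    {V₀ : ℂ} (he : HasDerivAt e e' z) (hU₀ : HasDerivAt (U 0) V₀ z)
    (hU : ∀ m, HasDerivAt (U (m + 1)) (V m) z) (n : ℕ) :
    HasDerivAt (fun z => ∑ j ∈ Finset.range (n + 1), e z ^ j / (j.factorial : ℂ) * U (n - j) z)
      (∑ j ∈ Finset.range n, e z ^ j / (j.factorial : ℂ) * (e' * U (n - 1 - j) z + V (n - 1 - j)) +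
        e z ^ n / (n.factorial : ℂ) * V₀) z := by
  -- `D` and `W` are the derivatives of the two factors, with index 0 treated apart: the power 0 is
  -- constant, and `U 0` has its own derivative `V₀`.
  let D : ℕ → ℂ := fun j => Nat.casesOn j 0 fun j => e z ^ j / (j.factorial : ℂ) * e'
  let W : ℕ → ℂ := fun m => Nat.casesOn m V₀ V
  have hD : ∀ j, HasDerivAt (fun z => e z ^ j / (j.factorial : ℂ)) (D j) z := by
    rintro (_ | j)
    · simpa using! hasDerivAt_const z (1 : ℂ)
    · exact hasDerivAt_pow_succ_div_factorial he j
  have hW : ∀ m, HasDerivAt (U m) (W m) z := by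
    rintro (_ | m)
    exacts [hU₀, hU m]
  refine (HasDerivAt.fun_sum fun j _ => (hD j).fun_mul (hW (n - j))).congr_deriv ?_
  have e1 : ∀ j ∈ Finset.range n, D (j + 1) * U (n - (j + 1)) z =
      e z ^ j / (j.factorial : ℂ) * e' * U (n - 1 - j) z := fun j _ => by
    rw [show n - (j + 1) = n - 1 - j by lia]
  have e2 : ∀ j ∈ Finset.range n, e z ^ j / (j.factorial : ℂ) * W (n - j) =
      e z ^ j / (j.factorial : ℂ) * V (n - 1 - j) := fun j hj => by
    rw [show n - j = n - 1 - j + 1 by have := Finset.mem_range.1 hj; lia]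
  rw [Finset.sum_add_distrib, Finset.sum_range_succ', Finset.sum_range_succ _ n,
    Finset.sum_congr rfl e1, Finset.sum_congr rfl e2, Nat.sub_self, show D 0 = 0 from rfl,
    show W 0 = V₀ from rfl]
  simp only [mul_add, Finset.sum_add_distrib, ← mul_assoc]
  ring

/-! ### The two functional equations -/

/-- The transformation of Nielsen polylogarithms under `z ↦ z / (z - 1)`. -/
theorem sum_nielsenIter_div_sub_one (n p : ℕ) : ∀ z ∈ doublyCutPlane,
    ∑ j ∈ Finset.range (n + 1),
        log (1 - z) ^ j / (j.factorial : ℂ) * nielsenIter (n - j) (p + 1) (z / (z - 1)) =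
      ∑ k ∈ Finset.range (n + 1),
        (-1) ^ (p + 1 + k) * ((p + k).choose k : ℂ) * nielsenIter (n - k) (p + 1 + k) z := by
  induction n with
  | zero =>
    intro z hz
    have hs : ((-1 : ℂ)) ^ (p + 1) * (-1) ^ (p + 1) = 1 := by rw [← mul_pow]; simp
    simp only [zero_add, Finset.sum_range_one, Nat.factorial_zero, Nat.sub_zero, add_zero,
      Nat.choose_zero_right, nielsenIter_zero_div_sub_one _ hz, nielsenIter_zero_left]
    rw [neg_pow (log (1 - z))]
    push_cast
    linear_combination (-log (1 - z) ^ (p + 1) / ((p + 1).factorial : ℂ)) * hs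
  | succ n ih =>
    refine eq_of_hasDerivAt_of_tendsto (c := 0)
      (f' := fun z => (∑ k ∈ Finset.range (n + 1),
        (-1) ^ (p + 1 + k) * ((p + k).choose k : ℂ) * nielsenIter (n - k) (p + 1 + k) z) / z -
        log (1 - z) ^ (n + 1) / ((n + 1).factorial : ℂ) *
          (log (1 - z) ^ p / (p.factorial : ℂ) * (1 - z)⁻¹))
      (fun z hz => ?_) (fun z hz => ?_) ?_ ?_
    · have hU₀ : HasDerivAt (fun z => nielsenIter 0 (p + 1) (z / (z - 1)))
          (log (1 - z) ^ p / (p.factorial : ℂ) * -(1 - z)⁻¹) z := by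
        refine (hasDerivAt_pow_succ_div_factorial
          (hasDerivAt_log_one_sub hz.2) p).congr_of_eventuallyEq ?_
        filter_upwards [isOpen_doublyCutPlane.mem_nhds hz] with w hw
        exact nielsenIter_zero_div_sub_one _ hw
      refine (hasDerivAt_sum_pow_div_factorial_mul
        (U := fun m z => nielsenIter m (p + 1) (z / (z - 1))) (hasDerivAt_log_one_sub hz.2) hU₀
        (fun m => hasDerivAt_nielsenIter_div_sub_one p.succ_ne_zero m hz) (n + 1)).congr_deriv ?_
      -- The `1/(1-z)` part of each derivative cancels against that of the logarithmic factor; the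
      -- `1/z` part is the induction hypothesis divided by `z`.
      rw [← ih z hz, Finset.sum_div, Nat.add_sub_cancel]
      refine Eq.trans (congrArg₂ (· + ·) ?_ ?_) (sub_eq_add_neg _ _).symm
      · refine Finset.sum_congr rfl fun j _ => ?_
        ring
      · ring
    · have hterm : ∀ k ∈ Finset.range (n + 1), HasDerivAt (fun z => (-1) ^ (p + 1 + k) *
          ((p + k).choose k : ℂ) * nielsenIter (n + 1 - k) (p + 1 + k) z)
          ((-1) ^ (p + 1 + k) * ((p + k).choose k : ℂ) *
            (nielsenIter (n - k) (p + 1 + k) z / z)) z := by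
        intro k hk
        rw [show n + 1 - k = n - k + 1 by have := Finset.mem_range.1 hk; lia]
        exact (hasDerivAt_nielsenIter_succ (by lia) _ hz.2 (slitPlane_ne_zero hz.1)).const_mul _
      have hlast : HasDerivAt (nielsenIter 0 (p + 1 + (n + 1)))
          ((-log (1 - z)) ^ (p + 1 + n) / ((p + 1 + n).factorial : ℂ) * (1 - z)⁻¹) z := by
        simpa using!
          hasDerivAt_pow_succ_div_factorial (hasDerivAt_log_one_sub hz.2).fun_neg (p + 1 + n)
      simp only [Finset.sum_range_succ _ (n + 1), Nat.sub_self]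
      refine ((HasDerivAt.fun_sum hterm).fun_add (hlast.const_mul _)).congr_deriv ?_
      rw [Finset.sum_div]
      refine Eq.trans (congrArg₂ (· + ·) ?_ ?_) (sub_eq_add_neg _ _).symm
      · exact Finset.sum_congr rfl fun k _ => (mul_div_assoc _ _ _).symm
      -- The binomial coefficient is what makes the derivatives of the two index-0 terms, multiples
      -- of `log(1-z)^(p+1+n)/(1-z)`, agree.
      · have hc : (((p + (n + 1)).choose (n + 1) : ℕ) : ℂ) * (p.factorial : ℂ) *
            ((n + 1).factorial : ℂ) = ((p + 1 + n).factorial : ℂ) := by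
          have := Nat.add_choose_mul_factorial_mul_factorial p (n + 1)
          rw [show p + 1 + n = p + (n + 1) by ring]
          exact_mod_cast this
        have h1 : (p.factorial : ℂ) ≠ 0 := by exact_mod_cast p.factorial_ne_zero
        have h2 : ((n + 1).factorial : ℂ) ≠ 0 := by exact_mod_cast (n + 1).factorial_ne_zero
        have h3 : ((p + 1 + n).factorial : ℂ) ≠ 0 := by
          exact_mod_cast (p + 1 + n).factorial_ne_zero
        have hz1 : 1 - z ≠ 0 := slitPlane_ne_zero hz.2
        have hs : ((-1 : ℂ)) ^ (p + 1 + n) * (-1) ^ (p + 1 + n) = 1 := by rw [← mul_pow]; simp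
        rw [neg_pow (log (1 - z)), show p + 1 + (n + 1) = p + 1 + n + 1 by ring, pow_succ (-1 : ℂ),
          ← hc]
        have h4 : (((p + (n + 1)).choose (n + 1) : ℕ) : ℂ) ≠ 0 := by
          exact_mod_cast (Nat.choose_pos (by lia)).ne'
        field_simp
        linear_combination (-log (1 - z) ^ (p + 1 + n)) * hs
    · rw [show (0 : ℂ) = ∑ j ∈ Finset.range (n + 1 + 1), 0 by simp]
      refine tendsto_finsetSum _ fun j _ => ?_
      simpa using ((tendsto_log_one_sub_nhdsGT_zero.pow j).div_const _).mul
        (tendsto_nielsenIter_div_sub_one p.succ_ne_zero (n + 1 - j))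
    · rw [show (0 : ℂ) = ∑ j ∈ Finset.range (n + 1 + 1), 0 by simp]
      refine tendsto_finsetSum _ fun k _ => ?_
      simpa using (tendsto_nielsenIter_nhdsGT_zero (show p + 1 + k ≠ 0 by lia)
        (n + 1 - k)).const_mul _

/-- The transformation of Nielsen polylogarithms under `z ↦ 1 - z`. -/
theorem sum_nielsenIter_one_sub {n : ℕ} (hn : n ≠ 0) (p : ℕ) {s : ℕ → ℂ}
    (hs : ∀ m ≠ 0, Tendsto (fun x : ℝ => nielsenIter m (p + 1) (1 - x)) (𝓝[>] 0) (𝓝 (s m))) :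
    ∀ z ∈ doublyCutPlane,
      ∑ j ∈ Finset.range (n + 1),
          (-log (1 - z)) ^ j / (j.factorial : ℂ) * nielsenIter (n - j) (p + 1) (1 - z) =
        s n - ∑ i ∈ Finset.range (p + 1),
          (-log z) ^ i / (i.factorial : ℂ) * nielsenIter (p - i + 1) n z := by
  refine eq_of_hasDerivAt_of_tendsto (c := s n)
    (f' := fun z => (-log (1 - z)) ^ n / (n.factorial : ℂ) *
      ((-log z) ^ p / (p.factorial : ℂ) * -z⁻¹)) (fun z hz => ?_) (fun z hz => ?_) ?_ ?_
  · have hU₀ : HasDerivAt (fun z => nielsenIter 0 (p + 1) (1 - z))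
        ((-log z) ^ p / (p.factorial : ℂ) * -z⁻¹) z := by
      simp only [nielsenIter_zero_one_sub]
      exact hasDerivAt_pow_succ_div_factorial (hasDerivAt_log hz.1).fun_neg p
    refine (hasDerivAt_sum_pow_div_factorial_mul
      (U := fun m z => nielsenIter m (p + 1) (1 - z)) (hasDerivAt_log_one_sub hz.2).fun_neg hU₀
      (fun m => hasDerivAt_nielsenIter_one_sub p.succ_ne_zero m hz) n).congr_deriv ?_
    -- Everything telescopes except the derivative of the index-0 term. The right-hand side leaves
    -- the same product of powers of `log z` and `log(1-z)`, so no induction is needed.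
    rw [Finset.sum_eq_zero fun j _ => by ring, zero_add]
  · have h := hasDerivAt_sum_pow_div_factorial_mul (U := fun m => nielsenIter (m + 1) n)
      (hasDerivAt_log hz.1).fun_neg
      (hasDerivAt_nielsenIter_succ hn 0 hz.2 (slitPlane_ne_zero hz.1))
      (fun m => hasDerivAt_nielsenIter_succ hn (m + 1) hz.2 (slitPlane_ne_zero hz.1)) p
    refine (h.const_sub (s n)).congr_deriv ?_
    rw [Finset.sum_eq_zero fun j _ => by ring, zero_add, nielsenIter_zero_left]
    ring
  · rw [show s n = ∑ j ∈ Finset.range (n + 1), if j = 0 then s n else 0 by simp]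
    refine tendsto_finsetSum _ fun j hj => ?_
    rcases Nat.eq_zero_or_pos j with rfl | hj0
    · simpa using hs n hn
    rw [if_neg hj0.ne']
    rcases (Nat.lt_succ_iff.1 (Finset.mem_range.1 hj)).eq_or_lt with rfl | hjn
    -- For `j = n` the factor `log^(p+1) x` diverges; one factor `log(1-x)` absorbs it, and the
    -- remaining `m` are harmless.
    · obtain ⟨m, rfl⟩ := Nat.exists_eq_succ_of_ne_zero hj0.ne'
      simp only [Nat.sub_self, nielsenIter_zero_one_sub]
      have h := ((tendsto_log_pow_mul_log_one_sub (p + 1)).mul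
        (tendsto_log_one_sub_nhdsGT_zero.pow m)).const_mul
          ((-1) ^ (m + 1) * (-1) ^ (p + 1) / (((m + 1).factorial : ℂ) * ((p + 1).factorial : ℂ)))
      rw [zero_mul, mul_zero] at h
      refine h.congr fun x => ?_
      rw [neg_pow (log (1 - _)), neg_pow (log _) (p + 1), Nat.succ_eq_add_one]
      ring
    · simpa [hj0.ne'] using ((tendsto_log_one_sub_nhdsGT_zero.neg.pow j).div_const _).mul
        (hs (n - j) (by lia))
  · suffices h : Tendsto (fun x : ℝ => ∑ i ∈ Finset.range (p + 1),
        (-log (x : ℂ)) ^ i / (i.factorial : ℂ) * nielsenIter (p - i + 1) n x) (𝓝[>] 0)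
        (𝓝 (∑ i ∈ Finset.range (p + 1), 0)) by
      simpa using h.const_sub (s n)
    refine tendsto_finsetSum _ fun i _ => ?_
    have h := (tendsto_log_pow_mul_nielsenIter hn (p - i + 1) i).const_mul
      ((-1) ^ i / (i.factorial : ℂ))
    rw [mul_zero] at h
    refine h.congr fun x => ?_
    rw [neg_pow (log _)]
    ring

/-! ### The three-term relation -/

theorem mem_doublyCutPlane_of_notMem {z : ℂ}
    (hz : z ∉ (fun x : ℝ => (x : ℂ)) '' (Iic 0 ∪ Ici 1)) : z ∈ doublyCutPlane := by
  simp only [doublyCutPlane, mem_ofPred_eq, mem_slitPlane_iff_not_le_zero]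
  constructor
  · intro h
    refine hz ⟨z.re, Or.inl h.1, ?_⟩
    apply Complex.ext <;> simp [h.2]
  · intro h
    have h1 : 1 - z.re ≤ 0 := by simpa using h.1
    have h2 : z.im = 0 := by simpa using h.2
    refine hz ⟨z.re, Or.inr (by simpa using h1), ?_⟩
    apply Complex.ext <;> simp [h2]

theorem mainTheorem9 (z : ℂ)
    (hz : z ∉ (fun x : ℝ => (x : ℂ)) '' (Set.Iic 0 ∪ Set.Ici 1)) :
    nielsenPolylog 4 2 (1 - z) + nielsenPolylog 4 2 z + nielsenPolylog 4 2 (z / (z - 1)) =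
      2 * classicalPolylog 6 (1 - z) + 2 * classicalPolylog 6 z
        + 2 * classicalPolylog 6 (z / (z - 1))
        - (classicalPolylog 5 z - classicalPolylog 5 (z / (z - 1))) * Complex.log (1 - z)
        - classicalPolylog 5 (1 - z) * Complex.log z
        - 3 / (Nat.factorial 6 : ℂ) * Complex.log (1 - z) ^ 6
        + 2 / (Nat.factorial 5 : ℂ) * Complex.log z * Complex.log (1 - z) ^ 5
        - 1 / ((Nat.factorial 2 : ℂ) * (Nat.factorial 4 : ℂ))
            * Complex.log z ^ 2 * Complex.log (1 - z) ^ 4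
        - 2 / (Nat.factorial 4 : ℂ) * riemannZeta 2 * Complex.log (1 - z) ^ 4
        + 1 / (Nat.factorial 3 : ℂ) * riemannZeta 2 * Complex.log z * Complex.log (1 - z) ^ 3
        - 1 / (Nat.factorial 3 : ℂ) * riemannZeta 3 * Complex.log (1 - z) ^ 3
        + 1 / (Nat.factorial 2 : ℂ) * riemannZeta 3 * Complex.log z * Complex.log (1 - z) ^ 2
        - 7 / (4 * (Nat.factorial 2 : ℂ)) * riemannZeta 4 * Complex.log (1 - z) ^ 2
        + riemannZeta 4 * Complex.log z * Complex.log (1 - z)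
        + riemannZeta 5 * Complex.log z
        - riemannZeta 2 * riemannZeta 3 * Complex.log (1 - z)
        - (1 / 2 * riemannZeta 3 ^ 2 + 5 / 4 * riemannZeta 6) := by
  have hD := mem_doublyCutPlane_of_notMem hz
  clear hz
  -- `lᵢn` and `rᵢn` are the equations for `S_{n,i}` at `z/(z-1)` and `1-z`; all lower `n` are
  -- needed to invert the truncated exponentials.
  have l₁1 := sum_nielsenIter_div_sub_one 1 0 z hD
  have l₁2 := sum_nielsenIter_div_sub_one 2 0 z hD
  have l₁3 := sum_nielsenIter_div_sub_one 3 0 z hD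
  have l₁4 := sum_nielsenIter_div_sub_one 4 0 z hD
  have l₁5 := sum_nielsenIter_div_sub_one 5 0 z hD
  have l₂1 := sum_nielsenIter_div_sub_one 1 1 z hD
  have l₂2 := sum_nielsenIter_div_sub_one 2 1 z hD
  have l₂3 := sum_nielsenIter_div_sub_one 3 1 z hD
  have l₂4 := sum_nielsenIter_div_sub_one 4 1 z hD
  have hr₁ := fun (n : ℕ) (hn : n ≠ 0) => sum_nielsenIter_one_sub hn 0
    (fun m hm => tendsto_nielsenIter_one (Nat.one_le_iff_ne_zero.2 hm)) z hD
  have hr₂ := fun (n : ℕ) (hn : n ≠ 0) => sum_nielsenIter_one_sub hn 1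
    (fun m hm => tendsto_nielsenIter_two (Nat.one_le_iff_ne_zero.2 hm)) z hD
  have r₁1 := hr₁ 1 (by norm_num)
  have r₁2 := hr₁ 2 (by norm_num)
  have r₁3 := hr₁ 3 (by norm_num)
  have r₁4 := hr₁ 4 (by norm_num)
  have r₁5 := hr₁ 5 (by norm_num)
  have r₂1 := hr₂ 1 (by norm_num)
  have r₂2 := hr₂ 2 (by norm_num)
  have r₂3 := hr₂ 3 (by norm_num)
  have r₂4 := hr₂ 4 (by norm_num)
  clear hr₁ hr₂
  simp only [Finset.sum_range_succ, Finset.sum_range_zero, nielsenIter_zero_div_sub_one _ hD,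
    sub_sub_cancel, nielsenIter_zero_left, doubleZeta_two_one, doubleZeta_three_one,
    doubleZeta_four_one, doubleZeta_five_one, Nat.factorial, Nat.reduceAdd, Nat.reduceSub,
    Nat.choose] at *
  have z2 := riemannZeta_eq_realZeta (k := 2) le_rfl
  have z3 := riemannZeta_eq_realZeta (k := 3) (by norm_num)
  have z4 := riemannZeta_eq_realZeta (k := 4) (by norm_num)
  have z5 := riemannZeta_eq_realZeta (k := 5) (by norm_num)
  have z6 := riemannZeta_eq_realZeta (k := 6) (by norm_num)
  push_cast at *
  rw [nielsenPolylog_eq_nielsenIter two_ne_zero 3 (one_sub_mem_cutPlane hD),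
    nielsenPolylog_eq_nielsenIter two_ne_zero 3 hD.2,
    nielsenPolylog_eq_nielsenIter two_ne_zero 3 (div_sub_one_mem_cutPlane hD)]
  simp only [classicalPolylog_succ_eq_nielsenIter, z2, z3, z4, z5, z6, Nat.reduceAdd]
  -- Each bracket is an equation system multiplied by the inverse exponential, isolating in turn
  -- `S_{4,2}(1-z)`, `S_{4,2}(z/(z-1))`, `Li_6(1-z)`, `Li_6(z/(z-1))`, `Li_5(z/(z-1))` and
  -- `Li_5(1-z)`. The outer factors are the coefficients of these functions in the claim.
  linear_combination (r₂4 + log (1 - z) * r₂3 + log (1 - z) ^ 2 / 2 * r₂2 +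
      log (1 - z) ^ 3 / 6 * r₂1)
    + (l₂4 - log (1 - z) * l₂3 + log (1 - z) ^ 2 / 2 * l₂2 - log (1 - z) ^ 3 / 6 * l₂1)
    - 2 * (r₁5 + log (1 - z) * r₁4 + log (1 - z) ^ 2 / 2 * r₁3 +
      log (1 - z) ^ 3 / 6 * r₁2 + log (1 - z) ^ 4 / 24 * r₁1)
    - 2 * (l₁5 - log (1 - z) * l₁4 + log (1 - z) ^ 2 / 2 * l₁3 -
      log (1 - z) ^ 3 / 6 * l₁2 + log (1 - z) ^ 4 / 24 * l₁1)
    - log (1 - z) * (l₁4 - log (1 - z) * l₁3 + log (1 - z) ^ 2 / 2 * l₁2 -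
      log (1 - z) ^ 3 / 6 * l₁1)
    + log z * (r₁4 + log (1 - z) * r₁3 + log (1 - z) ^ 2 / 2 * r₁2 + log (1 - z) ^ 3 / 6 * r₁1)
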